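/- Let $P$ be a finite poset (on $[n]$, with partial order not necessarily compatible with the labels) and let $K$ be a field. For a finite poset $Q$ on $[n]$, the enriched order polytope $\mathcal O^{(e)}_Q\subset\mathbb R^n$ is the convex hull of all vectors $\sum_{i\in \min(F)}\varepsilon_i\mathbf e_i+\sum_{i\in F\setminus\min(F)}\mathbf e_i$, where $F$ is a filter of $Q$, $\min(F)$ is its set of minimal elements, and $\varepsilon_i\in\{1,-1\}$. Let $\overline P$ be the dual poset of $P$, let $\mathcal J(P)$ be the set of poset ideals of $P$, and let $\max(I)$ be the set of maximal elements of $I\in\mathcal J(P)$. Write $I\nsim J$ if neither $I\subset J$ nor $J\subset I$. Consider the variables $x_I^{\varepsilon}$, where $I\in\mathcal J(P)$ and $\varepsilon\in\{-1,0,1\}^n$ satisfies $\varepsilon_i=\pm1$ for $i\in\max(I)$, $\varepsilon_i=1$ for $i\in I\setminus\max(I)$, and $\varepsilon_i=0$ for $i\notin I$. The map $(I,\varepsilon)\mapsto\varepsilon$ is a bijection from these indices onto $\mathcal O^{(e)}_{\overline P}\cap\mathbb Z^n$, so the toric ideal $I_{\mathcal O^{(e)}_{\overline P}}$ is the kernel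 of the $K$-algebra homomorphism $K[x_I^\varepsilon]\to K[t_1^{\pm1},\dots,t_n^{\pm1},s]$, $x_I^\varepsilon\mapsto t_1^{\varepsilon_1}\cdots t_n^{\varepsilon_n}s$. Let $<$ be any (graded) reverse lexicographic order on $K[x_I^\varepsilon]$ such that $x_I^\varepsilon<x_J^\mu$ whenever $I\subsetneq J$. Let $\mathcal G$ be the set of all binomials $$x_I^{\varepsilon}x_J^{\mu}-x_{I\setminus\{p\}}^{\varepsilon^{(p)}}x_{J\setminus\{p\}}^{\mu^{(p)}},\tag{1}$$ where $I,J\in\mathcal J(P)$, $p\in\max(I)\cap\max(J)$, $\varepsilon_p\ne\mu_p$, and $\varepsilon^{(p)},\mu^{(p)}$ are obtained from $\varepsilon,\mu$ by replacing the $p$-th entry by $0$, together with all binomials $$x_I^{\varepsilon}x_J^{\varepsilon'}-x_{I\cup J}^{\mu}x_{I\cap J}^{\mu'},\tag{2}$$ where $I,J\in\mathcal J(P)$, $I\nsim J$, and (a) $\varepsilon_p=\varepsilon'_p=\mu_p=\mu'_p$ for all $p\in\max(I)\cap\max(J)$; (b) for $p\in\max(I)\setminus\max(J)$: $\varepsilon_p=\mu_p$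 if $p\in\max(I\cup J)$, and $\varepsilon_p=\mu'_p$ if $p\in\max(I\cap J)$; (c) for $p\in\max(J)\setminus\max(I)$: $\varepsilon'_p=\mu_p$ if $p\in\max(I\cup J)$, and $\varepsilon'_p=\mu'_p$ if $p\in\max(I\cap J)$; (d) $\mu'_p=1$ for all $p\in\max(I\cap J)\setminus(\max(I)\cup\max(J))$. Then $\mathcal G$ is a Gröbner basis of $I_{\mathcal O^{(e)}_{\overline P}}$ with respect to $<$: it is a finite set of nonzero elements of the ideal whose initial monomials generate the initial ideal. The initial monomial of each binomial (1), (2) is its first monomial. In particular, the initial ideal is generated by squarefree quadratic monomials that do not involve the variable $x_\emptyset^{\mathbf 0}$ of the origin. -/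

import Mathlib

open scoped MonomialOrder

noncomputable section

/-! ### The reverse lexicographic order -/

/-- Exponent vectors, to be ordered by the (graded) reverse lexicographic order. -/
def DegRevLex (σ : Type*) : Type _ := σ →₀ ℕ

namespace DegRevLex

variable {σ : Type*}

instance : AddCommMonoid (DegRevLex σ) := inferInstanceAs (AddCommMonoid (σ →₀ ℕ))

/-- The identity map. -/
def equiv (σ : Type*) : (σ →₀ ℕ) ≃+ DegRevLex σ := AddEquiv.refl _

/-- The comparison key: first the total degree, then the reversed lexicographic order,
the lexicographic comparison starting at the smallest variable. -/
def key (a : DegRevLex σ) : ℕ ×ₗ (Lex (σ →₀ ℕ))ᵒᵈ :=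
  toLex (Finsupp.degree (σ := σ) (R := ℕ) a, OrderDual.toDual (toLex (α := σ →₀ ℕ) a))

theorem key_injective : Function.Injective (key (σ := σ)) := by
  intro a b h
  exact congrArg (fun k : ℕ ×ₗ (Lex (σ →₀ ℕ))ᵒᵈ => ofLex (OrderDual.ofDual (ofLex k).2)) h

instance [LinearOrder σ] : LinearOrder (DegRevLex σ) := LinearOrder.lift' key key_injective

theorem le_iff [LinearOrder σ] (a b : σ →₀ ℕ) :
    equiv σ a ≤ equiv σ b ↔ a.degree < b.degree ∨ a.degree = b.degree ∧ toLex b ≤ toLex a :=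
  Prod.Lex.toLex_le_toLex

/-- `a < b` when `a` has the smaller degree, or the degrees agree and the smallest variable
whose exponents in `a` and `b` differ has the larger exponent in `a`. -/
theorem lt_iff [LinearOrder σ] (a b : σ →₀ ℕ) :
    equiv σ a < equiv σ b ↔
      a.degree < b.degree ∨ a.degree = b.degree ∧ ∃ i, (∀ j < i, a j = b j) ∧ b i < a i := by
  refine Prod.Lex.toLex_lt_toLex.trans ?_
  refine or_congr Iff.rfl (and_congr Iff.rfl ?_)
  constructor
  · rintro ⟨i, h, h'⟩
    exact ⟨i, fun j hj => (h j hj).symm, h'⟩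
  · rintro ⟨i, h, h'⟩
    exact ⟨i, fun j hj => (h j hj).symm, h'⟩

instance [LinearOrder σ] : IsOrderedAddMonoid (DegRevLex σ) where
  add_le_add_left a b h c := by
    change equiv σ ((equiv σ).symm a) ≤ equiv σ ((equiv σ).symm b) at h
    change equiv σ ((equiv σ).symm a + (equiv σ).symm c) ≤
      equiv σ ((equiv σ).symm b + (equiv σ).symm c)
    rw [le_iff] at h ⊢
    simpa [map_add, toLex_add] using h

theorem finite_degree_eq [Finite σ] (d : ℕ) : {a : σ →₀ ℕ | a.degree = d}.Finite := by
  have h : (Set.univ.pi fun _ : σ => Set.Iic d).Finite := Set.Finite.pi fun _ => Set.finite_Iic d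
  refine (h.preimage (f := fun a : σ →₀ ℕ => (a : σ → ℕ)) DFunLike.coe_injective.injOn).subset ?_
  intro a ha i _
  exact (Finsupp.le_degree i a).trans (le_of_eq ha)

instance [LinearOrder σ] [Finite σ] : WellFoundedLT (DegRevLex σ) := by
  constructor
  have acc : ∀ d : ℕ, ∀ a : DegRevLex σ,
      Finsupp.degree (σ := σ) (R := ℕ) a = d → Acc (· < ·) a := by
    intro d
    induction d using Nat.strong_induction_on with
    | _ d ih =>
      have hwf : ({a : DegRevLex σ | Finsupp.degree (σ := σ) (R := ℕ) a = d}).WellFoundedOn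
          (· < ·) := Set.Finite.wellFoundedOn (α := DegRevLex σ) (finite_degree_eq (σ := σ) d)
      intro a ha
      refine hwf.induction (P := fun a => Acc (· < ·) a) (x := a) ha ?_
      intro y hy hrec
      refine Acc.intro _ fun z hz => ?_
      rcases (lt_iff (σ := σ) z y).1 hz with h | h
      · exact ih _ (lt_of_lt_of_eq h hy) z rfl
      · exact hrec z (h.1.trans hy) hz
  exact ⟨fun a => acc _ a rfl⟩

end DegRevLex

/-- The reverse lexicographic order on monomials in the linearly ordered variables `σ`. -/
def degRevLex (σ : Type*) [LinearOrder σ] [Finite σ] : MonomialOrder σ where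
  syn := DegRevLex σ
  toSyn := DegRevLex.equiv σ
  toSyn_monotone := by
    intro a b h
    rw [DegRevLex.le_iff]
    rcases (Finsupp.degree_mono h).lt_or_eq with h' | h'
    · exact Or.inl h'
    · refine Or.inr ⟨h', ?_⟩
      obtain ⟨c, rfl⟩ := exists_add_of_le h
      have hc : c = 0 := by simpa [map_add, Finsupp.degree_eq_zero_iff] using h'
      simp [hc]

/-! ### Initial ideals and Gröbner bases -/

section Groebner

variable {σ K : Type*} [Field K]

/-- The initial monomial of a polynomial. -/
def initialMonomial (m : MonomialOrder σ) (f : MvPolynomial σ K) : MvPolynomial σ K :=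
  MvPolynomial.monomial (m.degree f) 1

/-- The initial ideal: generated by the initial monomials of the nonzero elements. -/
def initialIdeal (m : MonomialOrder σ) (I : Ideal (MvPolynomial σ K)) :
    Ideal (MvPolynomial σ K) :=
  Ideal.span (initialMonomial m '' {f | f ∈ I ∧ f ≠ 0})

/-- `G` is a Gröbner basis of `I`: a finite set of nonzero elements of `I` whose initial
monomials generate the initial ideal of `I`. -/
def IsGroebnerBasis (m : MonomialOrder σ) (G : Set (MvPolynomial σ K))
    (I : Ideal (MvPolynomial σ K)) : Prop :=
  G.Finite ∧ (∀ g ∈ G, g ≠ 0) ∧ G ⊆ (I : Set (MvPolynomial σ K)) ∧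
    Ideal.span (initialMonomial m '' G) = initialIdeal m I

end Groebner

/-! ### Lattice polytopes and toric ideals -/

/-- The lattice points of a subset of `ℝ^ι`. -/
def latticePoints {ι : Type*} (Q : Set (ι → ℝ)) : Set (ι → ℤ) :=
  {a | (fun i => (a i : ℝ)) ∈ Q}

/-- The homomorphism `K[x_j : j ∈ σ] → K[t_i^{±1}, s : i ∈ ι]`, `x_j ↦ t^{a_j} s`. The target is
the monoid algebra of the monoid `ℤ^ι × ℕ` of monomials `t^c s^k`. -/
def toricHom (K : Type*) [Field K] {σ ι : Type*} (a : σ → ι → ℤ) :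
    MvPolynomial σ K →ₐ[K] AddMonoidAlgebra K ((ι → ℤ) × ℕ) :=
  MvPolynomial.aeval fun j => AddMonoidAlgebra.single (a j, 1) 1

/-- The toric ideal of the configuration `(a_j)`. It is the toric ideal of a lattice polytope
when `(a_j)` lists the lattice points of that polytope, without repetition. -/
def toricIdeal (K : Type*) [Field K] {σ ι : Type*} (a : σ → ι → ℤ) : Ideal (MvPolynomial σ K) :=
  RingHom.ker (toricHom K a)

/-! ### The enriched order polytope -/

section Polytope

variable {Q : Type*} [PartialOrder Q]

/-- The minimal elements of a filter. -/
def filterMin (F : UpperSet Q) : Set Q := {i | Minimal (· ∈ F) i}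

/-- The non-minimal elements of a filter. -/
def filterComin (F : UpperSet Q) : Set Q := (F : Set Q) \ filterMin F

/-- The signed incidence vector `e_X^ε`. -/
def signedVec (X : Set Q) (ε : Q → ℤˣ) : Q → ℝ := X.indicator fun i => ((ε i : ℤ) : ℝ)

/-- The enriched order polytope of a finite poset `Q`. -/
def enrichedOrderPolytope (Q : Type*) [PartialOrder Q] : Set (Q → ℝ) :=
  convexHull ℝ {v | ∃ (F : UpperSet Q) (ε : Q → ℤˣ),
    v = signedVec (filterMin F) ε + signedVec (filterComin F) 1}

end Polytope

/-! ### Signed poset ideals and the two families of binomials -/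

/-- The maximal elements of a poset ideal. -/
def idealMax {P : Type*} [PartialOrder P] (I : LowerSet P) : Set P := {i | Maximal (· ∈ I) i}

/-- The indices `(I, ε)` of the variables: a poset ideal `I` with `ε ∈ {-1,0,1}^P` which is `±1` on
the maximal elements of `I`, `1` on its other elements, and `0` outside `I`. -/
@[ext] structure SignedIdeal (P : Type*) [PartialOrder P] where
  ideal : LowerSet P
  sign : P → ℤ
  sign_max : ∀ i ∈ idealMax ideal, sign i = 1 ∨ sign i = -1
  sign_comax : ∀ i ∈ ideal, i ∉ idealMax ideal → sign i = 1
  sign_out : ∀ i, i ∉ ideal → sign i = 0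

namespace SignedIdeal

variable {P : Type*} [PartialOrder P]

/-- The index `(∅, 0)` of the variable of the origin. -/
def origin (P : Type*) [PartialOrder P] : SignedIdeal P where
  ideal := ⊥
  sign := 0
  sign_max := fun _ h => absurd h.prop (LowerSet.notMem_bot)
  sign_comax := fun _ h => absurd h (LowerSet.notMem_bot)
  sign_out := fun _ _ => rfl

instance [Finite P] : Finite (SignedIdeal P) := by
  have hT : Finite (P → Set.Icc (-1 : ℤ) 1) := inferInstance
  have hI : Finite (LowerSet P) := Finite.of_injective (fun I => (I : Set P)) SetLike.coe_injective
  have hb : ∀ (x : SignedIdeal P) (i : P), x.sign i ∈ Set.Icc (-1 : ℤ) 1 := by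
    intro x i
    by_cases h : i ∈ x.ideal
    · by_cases h' : i ∈ idealMax x.ideal
      · rcases x.sign_max i h' with h | h <;> simp [h]
      · simp [x.sign_comax i h h']
    · simp [x.sign_out i h]
  refine Finite.of_injective
    (fun x : SignedIdeal P => (x.ideal, fun i => (⟨x.sign i, hb x i⟩ : Set.Icc (-1 : ℤ) 1))) ?_
  intro x y h
  refine SignedIdeal.ext (congrArg Prod.fst h) (funext fun i => ?_)
  exact congrArg Subtype.val (congrFun (congrArg Prod.snd h) i)

/-- The exponent vector `ε` of the variable indexed by `(I, ε)`, as a point for the dual poset. -/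
def point (x : SignedIdeal P) : Pᵒᵈ → ℤ := fun i => x.sign (OrderDual.ofDual i)

/-- `z` is obtained from `x = (I, ε)` by deleting `p` from `I` and replacing `ε_p` by `0`. -/
def IsErase (p : P) (x z : SignedIdeal P) : Prop :=
  (z.ideal : Set P) = (x.ideal : Set P) \ {p} ∧ z.sign p = 0 ∧ ∀ q, q ≠ p → z.sign q = x.sign q

/-- The first family of binomials `x y - z w`: a common maximal element `p` with opposite signs is
deleted. -/
def IsCancel (x y z w : SignedIdeal P) : Prop :=
  ∃ p, p ∈ idealMax x.ideal ∧ p ∈ idealMax y.ideal ∧ x.sign p ≠ y.sign p ∧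
    IsErase p x z ∧ IsErase p y w

/-- The second family of binomials `x y - z w`: the signed Hibi relations. -/
structure IsSignedHibi (x y z w : SignedIdeal P) : Prop where
  not_le : ¬ x.ideal ≤ y.ideal
  not_ge : ¬ y.ideal ≤ x.ideal
  union : z.ideal = x.ideal ⊔ y.ideal
  inter : w.ideal = x.ideal ⊓ y.ideal
  both : ∀ p ∈ idealMax x.ideal ∩ idealMax y.ideal,
    x.sign p = y.sign p ∧ y.sign p = z.sign p ∧ z.sign p = w.sign p
  left : ∀ p ∈ idealMax x.ideal \ idealMax y.ideal,
    (p ∈ idealMax (x.ideal ⊔ y.ideal) → x.sign p = z.sign p) ∧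
    (p ∈ idealMax (x.ideal ⊓ y.ideal) → x.sign p = w.sign p)
  right : ∀ p ∈ idealMax y.ideal \ idealMax x.ideal,
    (p ∈ idealMax (x.ideal ⊔ y.ideal) → y.sign p = z.sign p) ∧
    (p ∈ idealMax (x.ideal ⊓ y.ideal) → y.sign p = w.sign p)
  new : ∀ p ∈ idealMax (x.ideal ⊓ y.ideal), p ∉ idealMax x.ideal → p ∉ idealMax y.ideal →
    w.sign p = 1

/-- The quadratic binomial `x y - z w`. -/
def binomial (K : Type*) [Field K] (x y z w : SignedIdeal P) : MvPolynomial (SignedIdeal P) K :=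
  MvPolynomial.X x * MvPolynomial.X y - MvPolynomial.X z * MvPolynomial.X w

/-- The set of all binomials of the two families. -/
def binomialSet (K : Type*) [Field K] (P : Type*) [PartialOrder P] :
    Set (MvPolynomial (SignedIdeal P) K) :=
  {f | ∃ x y z w, (IsCancel x y z w ∨ IsSignedHibi x y z w) ∧ f = binomial K x y z w}

end SignedIdeal

end

/-! Each binomial has both terms in one fibre of the toric map, with its first term larger, so it
suffices that a fibre contains at most one standard monomial, i.e. one divisible by no first term.
Given nonzero `f` in the ideal with standard leading monomial `m`, cancellation of coefficients
yields another monomial of `f` in the same fibre; reducing it by the binomials ends at a standard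
monomial no larger than it, which must be `m`, contradicting that `m` leads.

Uniqueness (`IsStandard.eq_of_toricWeight_eq`): in a standard monomial the ideals form a chain, and
common maximal elements carry equal signs. At a maximal element of the largest ideal all nonzero
contributions thus share one sign, so nothing cancels. The largest ideal is therefore the
down-closure of the support of the weight, and its signs are read off the weight; remove this
variable and induct on the degree. -/

/-! ### Fibres of the toric map on monomials. -/

section ToricFibre

variable {K : Type*} [Field K] {σ ι : Type*}

/-- The exponent `(c, k)` of the image `t^c s^k` of a monomial under `toricHom`. -/
noncomputable def toricWeight (a : σ → ι → ℤ) : (σ →₀ ℕ) →+ (ι → ℤ) × ℕ :=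
  Finsupp.liftAddHom fun j => multiplesHom _ (a j, 1)

theorem toricWeight_single_one (a : σ → ι → ℤ) (j : σ) :
    toricWeight a (Finsupp.single j 1) = (a j, 1) := by
  simp [toricWeight]

theorem toricWeight_fst (a : σ → ι → ℤ) (s : σ →₀ ℕ) (p : ι) :
    (toricWeight a s).1 p = ∑ j ∈ s.support, (s j : ℤ) * a j p := by
  simp [toricWeight, Finsupp.sum, Finset.sum_apply, Prod.fst_sum]

theorem toricWeight_snd (a : σ → ι → ℤ) (s : σ →₀ ℕ) : (toricWeight a s).2 = s.degree := by
  simp [toricWeight, Finsupp.sum, Prod.snd_sum, Finsupp.degree_apply]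

theorem toricHom_monomial (a : σ → ι → ℤ) (s : σ →₀ ℕ) (c : K) :
    toricHom K a (MvPolynomial.monomial s c) = AddMonoidAlgebra.single (toricWeight a s) c := by
  induction s using Finsupp.induction_linear generalizing c with
  | zero =>
    rw [map_zero]
    exact MvPolynomial.aeval_C _ c
  | add s t hs ht =>
    rw [← mul_one c, ← MvPolynomial.monomial_mul, map_mul, hs, ht,
      AddMonoidAlgebra.single_mul_single, map_add]
  | single j n =>
    rw [← mul_one c, ← MvPolynomial.C_mul_monomial, map_mul, ← MvPolynomial.X_pow_eq_monomial,
      map_pow, toricHom, MvPolynomial.aeval_X, AddMonoidAlgebra.single_pow, MvPolynomial.aeval_C]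
    simp [toricWeight, AddMonoidAlgebra.single_mul_single]

theorem monomial_sub_monomial_mem_toricIdeal (a : σ → ι → ℤ) {s t : σ →₀ ℕ}
    (h : toricWeight a s = toricWeight a t) (c : K) :
    MvPolynomial.monomial s c - MvPolynomial.monomial t c ∈ toricIdeal K a := by
  change toricHom K a _ = 0
  rw [map_sub, toricHom_monomial, toricHom_monomial, h, sub_self]

/-- Each coefficient of the image of `f` sums the coefficients of `f` over one fibre; a fibre
meeting the support in a single monomial could not sum to zero. -/
theorem exists_ne_toricWeight_eq_of_mem_toricIdeal (a : σ → ι → ℤ) {f : MvPolynomial σ K}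
    (hf : f ∈ toricIdeal K a) {s : σ →₀ ℕ} (hs : s ∈ f.support) :
    ∃ t ∈ f.support, t ≠ s ∧ toricWeight a t = toricWeight a s := by
  classical
  by_contra! h
  have h0 : toricHom K a f = 0 := hf
  rw [f.as_sum, map_sum] at h0
  simp only [toricHom_monomial] at h0
  have h1 := congrArg (fun g => g.coeff (toricWeight a s)) h0
  simp only [AddMonoidAlgebra.coeff_sum, AddMonoidAlgebra.coeff_single, Finsupp.finsetSum_apply,
    AddMonoidAlgebra.coeff_zero, Finsupp.zero_apply] at h1
  rw [Finset.sum_eq_single s] at h1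
  · exact MvPolynomial.mem_support_iff.1 hs (by simpa using h1)
  · intro t ht hts
    exact Finsupp.single_eq_of_ne' (h t ht hts)
  · exact fun h' => absurd hs h'

end ToricFibre

/-! ### Quadratic monomials. -/

/-- The smaller of `z`, `w` is the least variable whose exponents differ, and it divides only `z w`.
-/
theorem degRevLex_pair_lt_pair {σ : Type*} [LinearOrder σ] [Finite σ] {x y z w : σ}
    (hx : z ⊓ w < x) (hy : z ⊓ w < y) :
    (degRevLex σ).toSyn (Finsupp.single z 1 + Finsupp.single w 1) <
      (degRevLex σ).toSyn (Finsupp.single x 1 + Finsupp.single y 1) := by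
  classical
  refine (DegRevLex.lt_iff _ _).2 (Or.inr ⟨by simp [map_add], z ⊓ w, fun j hj => ?_, ?_⟩)
  · have h1 := hj.trans_le (inf_le_left : z ⊓ w ≤ z)
    have h2 := hj.trans_le (inf_le_right : z ⊓ w ≤ w)
    have h3 := hj.trans hx
    have h4 := hj.trans hy
    simp [h1.ne', h2.ne', h3.ne', h4.ne']
  · rw [Finsupp.add_apply, Finsupp.add_apply, Finsupp.single_eq_of_ne hx.ne,
      Finsupp.single_eq_of_ne hy.ne]
    rcases le_total z w with h | h <;> simp [h]

theorem pair_le_of_ne {σ : Type*} {s : σ →₀ ℕ} {x y : σ} (hx : x ∈ s.support) (hy : y ∈ s.support)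
    (h : x ≠ y) : Finsupp.single x 1 + Finsupp.single y 1 ≤ s := by
  classical
  intro i
  have h1 := Finsupp.mem_support_iff.1 hx
  have h2 := Finsupp.mem_support_iff.1 hy
  simp only [Finsupp.add_apply, Finsupp.single_apply]
  split_ifs with h3 h4 h4
  · exact absurd (h3.trans h4.symm) h
  · subst h3; omega
  · subst h4; omega
  · omega

namespace SignedIdeal

variable {P : Type*} [PartialOrder P]

/-! ### Maximal elements and signs. -/

theorem idealMax_anti {I J : LowerSet P} (h : I ≤ J) {p : P} (hp : p ∈ idealMax J) (hI : p ∈ I) :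
    p ∈ idealMax I := ⟨hI, fun _ hq hpq => hp.2 (h hq) hpq⟩

theorem notMem_idealMax_of_lt {I : LowerSet P} {p q : P} (hq : q ∈ I) (h : p < q) :
    p ∉ idealMax I := fun hp => h.not_ge (hp.2 hq h.le)

theorem exists_lt_of_notMem_idealMax {I : LowerSet P} {p : P} (hp : p ∈ I) (h : p ∉ idealMax I) :
    ∃ q ∈ I, p < q := by
  by_contra! h'
  exact h ⟨hp, fun q hq hpq => (eq_or_lt_of_le hpq).elim (fun e => e.ge) fun hl => absurd hl (h' q hq)⟩

theorem sign_mem (x : SignedIdeal P) {p : P} (hp : p ∈ x.ideal) : x.sign p = 1 ∨ x.sign p = -1 := by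
  by_cases h : p ∈ idealMax x.ideal
  · exact x.sign_max p h
  · exact Or.inl (x.sign_comax p hp h)

theorem sign_ne_zero_iff (x : SignedIdeal P) (p : P) : x.sign p ≠ 0 ↔ p ∈ x.ideal := by
  refine ⟨fun h => by_contra fun h' => h (x.sign_out p h'), fun h => ?_⟩
  rcases x.sign_mem h with h | h <;> simp [h]

theorem point_injective : Function.Injective (point (P := P)) := by
  intro x y h
  have hs : x.sign = y.sign := funext fun p => congrFun h (OrderDual.toDual p)
  refine SignedIdeal.ext (LowerSet.ext (Set.ext fun p => ?_)) hs
  exact (x.sign_ne_zero_iff p).symm.trans (hs ▸ y.sign_ne_zero_iff p)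

/-! ### Lattice points -/

/-- The filter of the dual poset with the same elements as the ideal of `x`. -/
def dualFilter (x : SignedIdeal P) : UpperSet Pᵒᵈ where
  carrier := {i | OrderDual.ofDual i ∈ x.ideal}
  upper' := fun _ _ hab ha => x.ideal.lower hab ha

theorem point_mem_latticePoints (x : SignedIdeal P) :
    point x ∈ latticePoints (enrichedOrderPolytope Pᵒᵈ) := by
  classical
  refine subset_convexHull ℝ _ ⟨x.dualFilter, fun i => if x.sign (OrderDual.ofDual i) = -1 then -1 else 1,
    funext fun i => ?_⟩
  have hmem : i ∈ (x.dualFilter : Set Pᵒᵈ) ↔ OrderDual.ofDual i ∈ x.ideal := Iff.rfl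
  have hmin : i ∈ filterMin x.dualFilter ↔ OrderDual.ofDual i ∈ idealMax x.ideal := Iff.rfl
  simp only [point, signedVec, filterComin, Pi.add_apply, Set.indicator_apply, Set.mem_sdiff, hmem,
    hmin]
  by_cases h : OrderDual.ofDual i ∈ idealMax x.ideal
  · rcases x.sign_max _ h with h' | h' <;> simp [h, h']
  · by_cases h2 : OrderDual.ofDual i ∈ x.ideal
    · simp [h, h2, x.sign_comax _ h2 h]
    · simp [h, h2, x.sign_out _ h2]

/-- The inequalities cut out a convex set, so the generators suffice: above an element of `F` the
coordinate is `1`, and off `F` it is `0`. No complete facet description is needed, only enough to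
pin down the lattice points. -/
theorem enrichedOrderPolytope_bounds {Q : Type*} [PartialOrder Q] {v : Q → ℝ}
    (hv : v ∈ enrichedOrderPolytope Q) :
    (∀ i, |v i| ≤ 1) ∧ ∀ i j, i < j → 2 * |v i| ≤ 1 + v j := by
  let C : Set (Q → ℝ) := {v | (∀ i, |v i| ≤ 1) ∧ ∀ i j, i < j → 2 * |v i| ≤ 1 + v j}
  have habs : ∀ {a b : ℝ} (x y : ℝ), 0 ≤ a → 0 ≤ b → |a * x + b * y| ≤ a * |x| + b * |y| := by
    intro a b x y ha hb
    refine (abs_add_le _ _).trans ?_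
    rw [abs_mul, abs_mul, abs_of_nonneg ha, abs_of_nonneg hb]
  have hC : Convex ℝ C := by
    intro x hx y hy a b ha hb hab
    refine ⟨fun i => ?_, fun i j hij => ?_⟩
    · have := habs (x i) (y i) ha hb
      have h1 := mul_le_mul_of_nonneg_left (hx.1 i) ha
      have h2 := mul_le_mul_of_nonneg_left (hy.1 i) hb
      simp only [Pi.add_apply, Pi.smul_apply, smul_eq_mul]
      linarith
    · have := habs (x i) (y i) ha hb
      have h1 := mul_le_mul_of_nonneg_left (hx.2 i j hij) ha
      have h2 := mul_le_mul_of_nonneg_left (hy.2 i j hij) hb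
      simp only [Pi.add_apply, Pi.smul_apply, smul_eq_mul]
      linarith
  refine convexHull_min (t := C) ?_ hC hv
  rintro _ ⟨F, ε, rfl⟩
  have hunit : ∀ i, |((ε i : ℤ) : ℝ)| = 1 := fun i => by
    rcases Int.units_eq_one_or (ε i) with h | h <;> simp [h]
  have hval : ∀ i, |(signedVec (filterMin F) ε + signedVec (filterComin F) 1) i| ≤ 1 := by
    intro i
    classical
    simp only [signedVec, filterComin, Pi.add_apply, Set.indicator_apply, Set.mem_sdiff]
    by_cases h1 : i ∈ filterMin F
    · simp [h1, hunit]
    · by_cases h2 : i ∈ F <;> simp [h1, h2]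
  refine ⟨hval, fun i j hij => ?_⟩
  by_cases hi : i ∈ F
  · have hj : j ∈ F := F.upper hij.le hi
    have hj' : j ∉ filterMin F := fun h => hij.not_ge (h.2 hi hij.le)
    have : (signedVec (filterMin F) ε + signedVec (filterComin F) 1) j = 1 := by
      simp [signedVec, filterComin, Set.indicator, hj, hj']
    rw [this]
    linarith [hval i]
  · have hi' : i ∉ filterMin F := fun h => hi h.prop
    have : (signedVec (filterMin F) ε + signedVec (filterComin F) 1) i = 0 := by
      simp [signedVec, filterComin, Set.indicator, hi, hi']
    rw [this, abs_zero]
    linarith [(abs_le.1 (hval j)).1]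

theorem exists_point_eq {c : Pᵒᵈ → ℤ} (hc : c ∈ latticePoints (enrichedOrderPolytope Pᵒᵈ)) :
    ∃ x : SignedIdeal P, point x = c := by
  obtain ⟨h1, h2⟩ := enrichedOrderPolytope_bounds hc
  replace h1 : ∀ i, |c i| ≤ 1 := fun i => by exact_mod_cast h1 i
  replace h2 : ∀ i j, i < j → 2 * |c i| ≤ 1 + c j := fun i j h => by exact_mod_cast h2 i j h
  -- Integrality turns the second bound into `2 ≤ 1 + c j`.
  have h3 : ∀ i j, i < j → c i ≠ 0 → c j = 1 := fun i j h h0 => by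
    have := h2 i j h
    have := abs_le.1 (h1 j)
    have := Int.one_le_abs h0
    omega
  refine ⟨⟨⟨{p | c (OrderDual.toDual p) ≠ 0}, fun p q hqp hp => ?_⟩,
    fun p => c (OrderDual.toDual p), fun p hp => ?_, fun p hp hp' => ?_, fun p hp => ?_⟩, rfl⟩
  · rcases hqp.eq_or_lt with rfl | h
    · exact hp
    · have := h3 (OrderDual.toDual p) (OrderDual.toDual q) h hp
      simp [this]
  · have : c (OrderDual.toDual p) ≠ 0 := hp.prop
    have := abs_le.1 (h1 (OrderDual.toDual p))
    omega
  · obtain ⟨q, hq, hpq⟩ := exists_lt_of_notMem_idealMax hp hp'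
    exact h3 (OrderDual.toDual q) (OrderDual.toDual p) hpq hq
  · exact not_not.1 hp

/-! ### The binomials -/

theorem point_add_of_isCancel {x y z w : SignedIdeal P} (h : IsCancel x y z w) :
    point x + point y = point z + point w := by
  obtain ⟨p, hx, hy, hne, ⟨-, hz, hz'⟩, ⟨-, hw, hw'⟩⟩ := h
  funext i
  change x.sign i.ofDual + y.sign i.ofDual = z.sign i.ofDual + w.sign i.ofDual
  by_cases hi : i.ofDual = p
  · rw [hi, hz, hw]
    rcases x.sign_max p hx with h1 | h1 <;> rcases y.sign_max p hy with h2 | h2 <;>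
      simp_all
  · rw [hz' _ hi, hw' _ hi]

theorem point_add_of_isSignedHibi {x y z w : SignedIdeal P} (h : IsSignedHibi x y z w) :
    point x + point y = point z + point w := by
  -- An element maximal in only one ideal passes its sign to `w` if it lies in the other ideal, and
  -- to `z` otherwise. Stated for arbitrary variables so that it also applies with `x` and `y`
  -- exchanged.
  have key : ∀ {x y z w : SignedIdeal P}, z.ideal = x.ideal ⊔ y.ideal → w.ideal = x.ideal ⊓ y.ideal →
      (∀ p ∈ idealMax x.ideal \ idealMax y.ideal,
        (p ∈ idealMax (x.ideal ⊔ y.ideal) → x.sign p = z.sign p) ∧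
        (p ∈ idealMax (x.ideal ⊓ y.ideal) → x.sign p = w.sign p)) →
      ∀ p ∈ idealMax x.ideal, p ∉ idealMax y.ideal →
        x.sign p + y.sign p = z.sign p + w.sign p := by
    intro x y z w hz hw hl p hp hp'
    have hpx : p ∈ x.ideal := hp.prop
    by_cases hpy : p ∈ y.ideal
    · obtain ⟨q, hq, hpq⟩ := exists_lt_of_notMem_idealMax hpy hp'
      have h1 : p ∈ idealMax (x.ideal ⊓ y.ideal) := idealMax_anti inf_le_left hp ⟨hpx, hpy⟩
      have h2 : p ∉ idealMax z.ideal := notMem_idealMax_of_lt (q := q) (hz ▸ Or.inr hq) hpq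
      rw [← (hl p ⟨hp, hp'⟩).2 h1, y.sign_comax p hpy hp', z.sign_comax p (hz ▸ Or.inl hpx) h2]
      ring
    · have h1 : p ∈ idealMax (x.ideal ⊔ y.ideal) := by
        refine ⟨Or.inl hpx, fun q hq hpq => ?_⟩
        rcases hq with hq | hq
        · exact hp.2 hq hpq
        · exact absurd (y.ideal.lower hpq hq) hpy
      rw [← (hl p ⟨hp, hp'⟩).1 h1, y.sign_out p hpy, w.sign_out p (hw ▸ fun h => hpy h.2)]
  funext i
  change x.sign i.ofDual + y.sign i.ofDual = z.sign i.ofDual + w.sign i.ofDual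
  generalize i.ofDual = p
  by_cases hx : p ∈ idealMax x.ideal
  · by_cases hy : p ∈ idealMax y.ideal
    · obtain ⟨h1, h2, h3⟩ := h.both p ⟨hx, hy⟩
      omega
    · exact key h.union h.inter h.left p hx hy
  · by_cases hy : p ∈ idealMax y.ideal
    · rw [add_comm (x.sign p)]
      refine key (x := y) (y := x) (h.union.trans (sup_comm _ _))
        (h.inter.trans (inf_comm _ _)) ?_ p hy hx
      rw [sup_comm, inf_comm]
      exact h.right
    · have hzmax : p ∉ idealMax z.ideal := by
        intro hp
        rw [h.union] at hp
        rcases hp.prop with h' | h'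
        · exact hx (idealMax_anti le_sup_left hp h')
        · exact hy (idealMax_anti le_sup_right hp h')
      by_cases hpx : p ∈ x.ideal
      · have hz := z.sign_comax p (h.union ▸ Or.inl hpx) hzmax
        by_cases hpy : p ∈ y.ideal
        · have hw : w.sign p = 1 := by
            by_cases hp : p ∈ idealMax w.ideal
            · exact h.new p (h.inter ▸ hp) hx hy
            · exact w.sign_comax p (h.inter ▸ ⟨hpx, hpy⟩) hp
          rw [hz, hw, x.sign_comax p hpx hx, y.sign_comax p hpy hy]
        · rw [hz, x.sign_comax p hpx hx, y.sign_out p hpy,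
            w.sign_out p (h.inter ▸ fun h => hpy h.2)]
      · rw [x.sign_out p hpx, w.sign_out p (h.inter ▸ fun h => hpx h.1)]
        by_cases hpy : p ∈ y.ideal
        · rw [z.sign_comax p (h.union ▸ Or.inr hpy) hzmax, y.sign_comax p hpy hy]
          ring
        · rw [y.sign_out p hpy, z.sign_out p (h.union ▸ fun h => h.elim hpx hpy)]

theorem IsErase.ideal_lt {p : P} {x z : SignedIdeal P} (h : IsErase p x z) (hp : p ∈ x.ideal) :
    z.ideal < x.ideal := by
  refine lt_of_le_of_ne (fun q hq => ?_) fun e => ?_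
  · exact (h.1 ▸ hq : q ∈ (x.ideal : Set P) \ {p}).1
  · have h1 : p ∈ (x.ideal : Set P) \ {p} := h.1 ▸ e ▸ hp
    exact h1.2 rfl

theorem exists_isErase {p : P} {x : SignedIdeal P} (hp : p ∈ idealMax x.ideal) :
    ∃ z, IsErase p x z := by
  classical
  refine ⟨⟨⟨(x.ideal : Set P) \ {p}, fun a b hba ha => ⟨x.ideal.lower hba ha.1, ?_⟩⟩,
    Function.update x.sign p 0, fun i hi => ?_, fun i hi hi' => ?_, fun i hi => ?_⟩,
    rfl, by simp, fun q hq => by simp [hq]⟩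
  · rintro rfl
    exact ha.2 (le_antisymm (hp.2 ha.1 hba) hba)
  · have h1 : i ∈ x.ideal ∧ i ≠ p := hi.prop
    simpa [h1.2] using x.sign_mem h1.1
  · have h1 : i ∈ x.ideal ∧ i ≠ p := hi
    obtain ⟨q, hq, hiq⟩ := exists_lt_of_notMem_idealMax hi hi'
    have hq' : q ∈ x.ideal := hq.1
    simpa [h1.2] using x.sign_comax i h1.1 (notMem_idealMax_of_lt hq' hiq)
  · by_cases h : i = p
    · simp [h]
    · simpa [h] using x.sign_out i fun h' => hi ⟨h', h⟩

theorem exists_isCancel {p : P} {x y : SignedIdeal P} (hx : p ∈ idealMax x.ideal)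
    (hy : p ∈ idealMax y.ideal) (h : x.sign p ≠ y.sign p) : ∃ z w, IsCancel x y z w := by
  obtain ⟨z, hz⟩ := exists_isErase hx
  obtain ⟨w, hw⟩ := exists_isErase hy
  exact ⟨z, w, p, hx, hy, h, hz, hw⟩

open Classical in
/-- The signed ideal on `I` with the signs `ε` on its maximal elements. -/
noncomputable def ofSigns (I : LowerSet P) (ε : P → ℤ) (hε : ∀ p ∈ idealMax I, ε p = 1 ∨ ε p = -1) :
    SignedIdeal P where
  ideal := I
  sign := fun p => if p ∈ idealMax I then ε p else if p ∈ I then 1 else 0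
  sign_max := fun p hp => by simpa [hp] using hε p hp
  sign_comax := fun p hp hp' => by simp [hp, hp']
  sign_out := fun p hp => by
    have : p ∉ idealMax I := fun h => hp h.prop
    simp [hp, this]

theorem ofSigns_sign {I : LowerSet P} {ε : P → ℤ} (hε : ∀ p ∈ idealMax I, ε p = 1 ∨ ε p = -1)
    {p : P} (hp : p ∈ idealMax I) : (ofSigns I ε hε).sign p = ε p := by
  simp [ofSigns, hp]

/-- Agreement on common maximal elements lets a single sign function serve both the union and the
intersection. -/
theorem exists_isSignedHibi {x y : SignedIdeal P} (hxy : ¬ x.ideal ≤ y.ideal)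
    (hyx : ¬ y.ideal ≤ x.ideal)
    (hs : ∀ p, p ∈ idealMax x.ideal → p ∈ idealMax y.ideal → x.sign p = y.sign p) :
    ∃ z w, IsSignedHibi x y z w := by
  classical
  -- The default `1` is the sign required at maximal elements of the intersection that are maximal
  -- in neither ideal.
  let ε : P → ℤ := fun p =>
    if p ∈ idealMax x.ideal then x.sign p else if p ∈ idealMax y.ideal then y.sign p else 1
  have hε : ∀ p, ε p = 1 ∨ ε p = -1 := by
    intro p
    by_cases hx : p ∈ idealMax x.ideal
    · simpa [ε, hx] using x.sign_max p hx
    · by_cases hy : p ∈ idealMax y.ideal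
      · simpa [ε, hx, hy] using y.sign_max p hy
      · simp [ε, hx, hy]
  refine ⟨ofSigns (x.ideal ⊔ y.ideal) ε fun p _ => hε p,
    ofSigns (x.ideal ⊓ y.ideal) ε fun p _ => hε p, hxy, hyx, rfl, rfl, ?_, ?_, ?_, ?_⟩
  · rintro p ⟨hx, hy⟩
    have h1 : p ∈ idealMax (x.ideal ⊔ y.ideal) :=
      ⟨Or.inl hx.prop, fun q hq hpq => hq.elim (fun h => hx.2 h hpq) fun h => hy.2 h hpq⟩
    have h2 : p ∈ idealMax (x.ideal ⊓ y.ideal) := idealMax_anti inf_le_left hx ⟨hx.prop, hy.prop⟩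
    rw [ofSigns_sign _ h1, ofSigns_sign _ h2]
    simp [ε, hx, hs p hx hy]
  · rintro p ⟨hx, hy⟩
    refine ⟨fun h => ?_, fun h => ?_⟩ <;> rw [ofSigns_sign _ h] <;> simp [ε, hx]
  · rintro p ⟨hy, hx⟩
    refine ⟨fun h => ?_, fun h => ?_⟩ <;> rw [ofSigns_sign _ h] <;> simp [ε, hx, hy]
  · intro p h hx hy
    rw [ofSigns_sign _ h]
    simp [ε, hx, hy]

/-- This makes the initial monomials squarefree, and lets divisibility be tested on supports without
multiplicities. -/
theorem ne_of_relation {x y z w : SignedIdeal P} (h : IsCancel x y z w ∨ IsSignedHibi x y z w) :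
    x ≠ y := by
  rintro rfl
  rcases h with ⟨p, -, -, h, -⟩ | h
  · exact h rfl
  · exact h.not_le le_rfl

theorem ne_origin_of_relation {x y z w : SignedIdeal P}
    (h : IsCancel x y z w ∨ IsSignedHibi x y z w) : x ≠ origin P ∧ y ≠ origin P := by
  rcases h with ⟨p, hx, hy, -⟩ | h
  · refine ⟨?_, ?_⟩
    · rintro rfl
      exact LowerSet.notMem_bot hx.prop
    · rintro rfl
      exact LowerSet.notMem_bot hy.prop
  · refine ⟨?_, ?_⟩
    · rintro rfl
      exact h.not_le bot_le
    · rintro rfl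
      exact h.not_ge bot_le

theorem toricWeight_pair_eq_of_relation {x y z w : SignedIdeal P}
    (h : IsCancel x y z w ∨ IsSignedHibi x y z w) :
    toricWeight point (Finsupp.single x 1 + Finsupp.single y 1) =
      toricWeight point (Finsupp.single z 1 + Finsupp.single w 1) := by
  simp only [map_add, toricWeight_single_one, Prod.mk_add_mk]
  rw [h.elim point_add_of_isCancel point_add_of_isSignedHibi]

theorem binomial_eq (K : Type*) [Field K] (x y z w : SignedIdeal P) :
    binomial K x y z w = MvPolynomial.monomial (Finsupp.single x 1 + Finsupp.single y 1) 1 -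
      MvPolynomial.monomial (Finsupp.single z 1 + Finsupp.single w 1) 1 := by
  simp [binomial, MvPolynomial.X, MvPolynomial.monomial_mul]

/-! ### Standard monomials -/

/-- A monomial divisible by no initial monomial of the two families of binomials. -/
def IsStandard (s : SignedIdeal P →₀ ℕ) : Prop :=
  ∀ x ∈ s.support, ∀ y ∈ s.support, ∀ z w, ¬ (IsCancel x y z w ∨ IsSignedHibi x y z w)

theorem IsStandard.sign_eq {s : SignedIdeal P →₀ ℕ} (hs : IsStandard s) {x y : SignedIdeal P}
    (hx : x ∈ s.support) (hy : y ∈ s.support) {p : P} (hpx : p ∈ idealMax x.ideal)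
    (hpy : p ∈ idealMax y.ideal) : x.sign p = y.sign p := by
  by_contra h
  obtain ⟨z, w, h⟩ := exists_isCancel hpx hpy h
  exact hs x hx y hy z w (Or.inl h)

theorem IsStandard.ideal_le_total {s : SignedIdeal P →₀ ℕ} (hs : IsStandard s)
    {x y : SignedIdeal P} (hx : x ∈ s.support) (hy : y ∈ s.support) :
    x.ideal ≤ y.ideal ∨ y.ideal ≤ x.ideal := by
  by_contra! h
  obtain ⟨z, w, h⟩ := exists_isSignedHibi h.1 h.2 fun p => hs.sign_eq hx hy
  exact hs x hx y hy z w (Or.inr h)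

theorem IsStandard.exists_top {s : SignedIdeal P →₀ ℕ} (hs : IsStandard s) (h0 : s ≠ 0) :
    ∃ x ∈ s.support, ∀ y ∈ s.support, y.ideal ≤ x.ideal := by
  obtain ⟨x, hx, hmax⟩ := s.support.exists_maximalFor SignedIdeal.ideal
    (Finsupp.support_nonempty_iff.2 h0)
  exact ⟨x, hx, fun y hy => (hs.ideal_le_total hx hy).elim (fun h => hmax hy h) id⟩

/-- A maximal element of the top ideal is maximal in every smaller ideal containing it, so all its
signs agree and no cancellation occurs. -/
theorem IsStandard.weight_of_idealMax_top {s : SignedIdeal P →₀ ℕ} (hs : IsStandard s)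
    {x : SignedIdeal P} (hx : x ∈ s.support) (htop : ∀ y ∈ s.support, y.ideal ≤ x.ideal) {p : P}
    (hp : p ∈ idealMax x.ideal) :
    0 < (toricWeight point s).1 (OrderDual.toDual p) * x.sign p := by
  rw [toricWeight_fst, Finset.sum_mul]
  have hsq : ∀ y ∈ s.support, p ∈ y.ideal →
      point y (OrderDual.toDual p) * x.sign p = 1 := by
    intro y hy hpy
    have h1 := idealMax_anti (htop y hy) hp hpy
    change y.sign p * x.sign p = 1
    rw [hs.sign_eq hy hx h1 hp]
    rcases x.sign_max p hp with h | h <;> simp [h]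
  refine Finset.sum_pos' (fun y hy => ?_) ⟨x, hx, ?_⟩
  · by_cases hpy : p ∈ y.ideal
    · rw [mul_assoc, hsq y hy hpy]
      positivity
    · have : point y (OrderDual.toDual p) = 0 := y.sign_out p hpy
      simp [this]
  · rw [mul_assoc, hsq x hx hp.prop, mul_one]
    exact_mod_cast Nat.pos_of_ne_zero (Finsupp.mem_support_iff.1 hx)

/-- The right-hand side depends only on the weight, so the fibre determines the top ideal. -/
theorem IsStandard.mem_top_iff [Finite P] {s : SignedIdeal P →₀ ℕ} (hs : IsStandard s)
    {x : SignedIdeal P} (hx : x ∈ s.support) (htop : ∀ y ∈ s.support, y.ideal ≤ x.ideal) (p : P) :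
    p ∈ x.ideal ↔ ∃ q, p ≤ q ∧ (toricWeight point s).1 (OrderDual.toDual q) ≠ 0 := by
  constructor
  · intro hp
    obtain ⟨q, hpq, hq⟩ := (Set.toFinite (x.ideal : Set P)).exists_le_maximal hp
    have h := hs.weight_of_idealMax_top hx htop (p := q) hq
    exact ⟨q, hpq, fun h0 => by simp [h0] at h⟩
  · rintro ⟨q, hpq, hq⟩
    rw [toricWeight_fst] at hq
    obtain ⟨y, hy, hne⟩ := Finset.exists_ne_zero_of_sum_ne_zero hq
    have h1 : y.sign q ≠ 0 := right_ne_zero_of_mul hne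
    exact htop y hy (y.ideal.lower hpq ((y.sign_ne_zero_iff q).1 h1))

theorem IsStandard.top_eq [Finite P] {s t : SignedIdeal P →₀ ℕ} (hs : IsStandard s)
    (ht : IsStandard t) (hst : toricWeight point s = toricWeight point t) {x y : SignedIdeal P}
    (hx : x ∈ s.support) (hxtop : ∀ z ∈ s.support, z.ideal ≤ x.ideal)
    (hy : y ∈ t.support) (hytop : ∀ z ∈ t.support, z.ideal ≤ y.ideal) : x = y := by
  have hI : x.ideal = y.ideal := by
    refine LowerSet.ext (Set.ext fun p => ?_)
    exact (hs.mem_top_iff hx hxtop p).trans (hst ▸ (ht.mem_top_iff hy hytop p).symm)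
  refine SignedIdeal.ext hI (funext fun p => ?_)
  by_cases hp : p ∈ idealMax x.ideal
  · have h1 := hs.weight_of_idealMax_top hx hxtop hp
    have h2 := ht.weight_of_idealMax_top hy hytop (p := p) (hI ▸ hp)
    rw [hst] at h1
    rcases x.sign_max p hp with h3 | h3 <;> rcases y.sign_max p (hI ▸ hp) with h4 | h4 <;>
      rw [h3] at h1 <;> rw [h4] at h2 <;> omega
  · by_cases hp' : p ∈ x.ideal
    · rw [x.sign_comax p hp' hp, y.sign_comax p (hI ▸ hp') (hI ▸ hp)]
    · rw [x.sign_out p hp', y.sign_out p (hI ▸ hp')]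

theorem IsStandard.eq_of_toricWeight_eq [Finite P] {s t : SignedIdeal P →₀ ℕ} (hs : IsStandard s)
    (ht : IsStandard t) (hst : toricWeight point s = toricWeight point t) : s = t := by
  have hdeg : s.degree = t.degree := by rw [← toricWeight_snd point, hst, toricWeight_snd]
  induction hn : s.degree generalizing s t with
  | zero =>
    rw [(Finsupp.degree_eq_zero_iff s).1 hn, (Finsupp.degree_eq_zero_iff t).1 (hdeg ▸ hn)]
  | succ n ih =>
    have hs0 : s ≠ 0 := by rintro rfl; simp at hn
    have ht0 : t ≠ 0 := by rintro rfl; simp [hn] at hdeg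
    obtain ⟨x, hx, hxtop⟩ := hs.exists_top hs0
    obtain ⟨y, hy, hytop⟩ := ht.exists_top ht0
    obtain rfl := hs.top_eq ht hst hx hxtop hy hytop
    have split : ∀ {u : SignedIdeal P →₀ ℕ}, x ∈ u.support → ∃ u', u = Finsupp.single x 1 + u' :=
      fun {u} hu => exists_add_of_le (Finsupp.single_le_iff.2
        (Nat.one_le_iff_ne_zero.2 (Finsupp.mem_support_iff.1 hu)))
    obtain ⟨s', rfl⟩ := split hx
    obtain ⟨t', rfl⟩ := split hy
    -- Divisors of standard monomials are standard, so the common top variable can be cancelled.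
    have sub : ∀ {u : SignedIdeal P →₀ ℕ}, IsStandard (Finsupp.single x 1 + u) → IsStandard u := by
      intro u hu a ha b hb
      exact hu a (Finsupp.support_mono le_add_self ha) b (Finsupp.support_mono le_add_self hb)
    have hw : toricWeight point s' = toricWeight point t' := by
      rw [map_add, map_add] at hst
      exact add_left_cancel hst
    simp only [map_add, Finsupp.degree_single] at hn hdeg
    rw [ih (sub hs) (sub ht) hw (by omega) (by omega)]

/-! ### The Gröbner basis -/

section Order

variable [Finite P] [LinearOrder (SignedIdeal P)]

/-- Erasing shrinks both ideals, giving `z < x` and `w < y`; for incomparable ideals the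
intersection is strictly inside both, giving `w < x` and `w < y`. -/
theorem pair_lt_of_relation (hlt : ∀ x y : SignedIdeal P, x.ideal < y.ideal → x < y)
    {x y z w : SignedIdeal P} (h : IsCancel x y z w ∨ IsSignedHibi x y z w) :
    (degRevLex (SignedIdeal P)).toSyn (Finsupp.single z 1 + Finsupp.single w 1) <
      (degRevLex (SignedIdeal P)).toSyn (Finsupp.single x 1 + Finsupp.single y 1) := by
  rcases h with ⟨p, hx, hy, -, hz, hw⟩ | h
  · exact degRevLex_pair_lt_pair (inf_le_left.trans_lt (hlt z x (hz.ideal_lt hx.prop)))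
      (inf_le_right.trans_lt (hlt w y (hw.ideal_lt hy.prop)))
  · refine degRevLex_pair_lt_pair (inf_le_right.trans_lt (hlt w x ?_))
      (inf_le_right.trans_lt (hlt w y ?_))
    · rw [h.inter]
      exact inf_lt_left.2 h.not_le
    · rw [h.inter]
      exact inf_lt_right.2 h.not_ge

theorem initialMonomial_binomial {K : Type*} [Field K]
    (hlt : ∀ x y : SignedIdeal P, x.ideal < y.ideal → x < y)
    {x y z w : SignedIdeal P} (h : IsCancel x y z w ∨ IsSignedHibi x y z w) :
    initialMonomial (degRevLex (SignedIdeal P)) (binomial K x y z w) =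
      MvPolynomial.monomial (Finsupp.single x 1 + Finsupp.single y 1) 1 := by
  classical
  have hd : ∀ s : SignedIdeal P →₀ ℕ,
      (degRevLex (SignedIdeal P)).degree (MvPolynomial.monomial s (1 : K)) = s := fun s => by
    rw [MonomialOrder.degree_monomial, if_neg one_ne_zero]
  rw [initialMonomial, binomial_eq, MonomialOrder.degree_sub_of_lt, hd]
  rw [hd, hd]
  exact pair_lt_of_relation hlt h

theorem exists_lt_of_not_isStandard (hlt : ∀ x y : SignedIdeal P, x.ideal < y.ideal → x < y)
    {s : SignedIdeal P →₀ ℕ} (hs : ¬ IsStandard s) :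
    ∃ t, toricWeight point t = toricWeight point s ∧
      (degRevLex (SignedIdeal P)).toSyn t < (degRevLex (SignedIdeal P)).toSyn s := by
  simp only [IsStandard, not_forall, not_not] at hs
  obtain ⟨x, hx, y, hy, z, w, h⟩ := hs
  obtain ⟨u, rfl⟩ := exists_add_of_le (pair_le_of_ne hx hy (ne_of_relation h))
  refine ⟨Finsupp.single z 1 + Finsupp.single w 1 + u, ?_, ?_⟩
  · rw [map_add, map_add _ _ u, toricWeight_pair_eq_of_relation h]
  · rw [map_add, map_add _ _ u]
    exact add_lt_add_left (pair_lt_of_relation hlt h) _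

theorem exists_isStandard_le (hlt : ∀ x y : SignedIdeal P, x.ideal < y.ideal → x < y)
    (s : SignedIdeal P →₀ ℕ) :
    ∃ t, IsStandard t ∧ toricWeight point t = toricWeight point s ∧
      (degRevLex (SignedIdeal P)).toSyn t ≤ (degRevLex (SignedIdeal P)).toSyn s := by
  have hwf : WellFounded fun a b : SignedIdeal P →₀ ℕ =>
      (degRevLex (SignedIdeal P)).toSyn a < (degRevLex (SignedIdeal P)).toSyn b :=
    InvImage.wf _ wellFounded_lt
  induction s using hwf.induction with
  | _ s ih =>
    by_cases hs : IsStandard s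
    · exact ⟨s, hs, rfl, le_rfl⟩
    · obtain ⟨t, ht, hts⟩ := exists_lt_of_not_isStandard hlt hs
      obtain ⟨u, hu, hut, hle⟩ := ih t hts
      exact ⟨u, hu, hut.trans ht, hle.trans hts.le⟩

theorem not_isStandard_degree {K : Type*} [Field K]
    (hlt : ∀ x y : SignedIdeal P, x.ideal < y.ideal → x < y) {f : MvPolynomial (SignedIdeal P) K}
    (hf : f ∈ toricIdeal K (point (P := P))) (hf0 : f ≠ 0) :
    ¬ IsStandard ((degRevLex (SignedIdeal P)).degree f) := by
  intro hs
  obtain ⟨t, ht, hne, hw⟩ := exists_ne_toricWeight_eq_of_mem_toricIdeal point hf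
    ((degRevLex (SignedIdeal P)).degree_mem_support hf0)
  obtain ⟨u, hu, hut, hle⟩ := exists_isStandard_le hlt t
  -- Uniqueness identifies `u` with the leading exponent, so that exponent is at most `t`, hence
  -- equal to it.
  rw [hu.eq_of_toricWeight_eq hs (hut.trans hw)] at hle
  exact hne ((degRevLex (SignedIdeal P)).toSyn.injective
    (le_antisymm ((degRevLex (SignedIdeal P)).le_degree ht) hle))

theorem isGroebnerBasis_binomialSet (K : Type*) [Field K]
    (hlt : ∀ x y : SignedIdeal P, x.ideal < y.ideal → x < y) :
    IsGroebnerBasis (degRevLex (SignedIdeal P)) (binomialSet K P)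
      (toricIdeal K (point (P := P))) := by
  have hmem : ∀ g ∈ binomialSet K P, g ∈ toricIdeal K (point (P := P)) := by
    rintro _ ⟨x, y, z, w, h, rfl⟩
    rw [binomial_eq]
    exact monomial_sub_monomial_mem_toricIdeal point (toricWeight_pair_eq_of_relation h) 1
  have hne : ∀ g ∈ binomialSet K P, g ≠ 0 := by
    rintro _ ⟨x, y, z, w, h, rfl⟩
    rw [binomial_eq, sub_ne_zero]
    intro e
    refine (pair_lt_of_relation hlt h).ne ?_
    rw [MvPolynomial.monomial_left_injective one_ne_zero e]
  refine ⟨?_, hne, hmem, le_antisymm (Ideal.span_mono ?_) (Ideal.span_le.2 ?_)⟩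
  · refine (Set.finite_range fun v : SignedIdeal P × SignedIdeal P × SignedIdeal P × SignedIdeal P =>
      binomial K v.1 v.2.1 v.2.2.1 v.2.2.2).subset ?_
    rintro _ ⟨x, y, z, w, -, rfl⟩
    exact ⟨(x, y, z, w), rfl⟩
  · exact Set.image_mono fun g hg => ⟨hmem g hg, hne g hg⟩
  · rintro _ ⟨f, ⟨hf, hf0⟩, rfl⟩
    have h := not_isStandard_degree hlt hf hf0
    simp only [IsStandard, not_forall, not_not] at h
    obtain ⟨x, hx, y, hy, z, w, h⟩ := h
    -- Nonstandardness of the leading exponent provides a first term `x y` dividing it.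
    obtain ⟨u, hu⟩ := exists_add_of_le (pair_le_of_ne hx hy (ne_of_relation h))
    rw [initialMonomial, hu, ← mul_one (1 : K), ← MvPolynomial.monomial_mul]
    refine Ideal.mul_mem_right _ _ (Ideal.subset_span ⟨binomial K x y z w, ⟨x, y, z, w, h, rfl⟩, ?_⟩)
    exact initialMonomial_binomial hlt h

end Order

end SignedIdeal

theorem mainTheorem3 {P : Type*} [PartialOrder P] [Finite P] {K : Type*} [Field K] :
    -- the exponent vectors list the lattice points of the polytope of the dual poset exactly once
    Set.BijOn (SignedIdeal.point (P := P)) Set.univ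
      (latticePoints (enrichedOrderPolytope Pᵒᵈ)) ∧
    ∀ (_ : LinearOrder (SignedIdeal P)),
      (∀ x y : SignedIdeal P, x.ideal < y.ideal → x < y) →
      IsGroebnerBasis (degRevLex (SignedIdeal P)) (SignedIdeal.binomialSet K P)
        (toricIdeal K (SignedIdeal.point (P := P))) ∧
      (∀ x y z w : SignedIdeal P,
        SignedIdeal.IsCancel x y z w ∨ SignedIdeal.IsSignedHibi x y z w →
        initialMonomial (degRevLex (SignedIdeal P)) (SignedIdeal.binomial K x y z w) =
          MvPolynomial.X x * MvPolynomial.X y) ∧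
      ∃ S : Set (SignedIdeal P →₀ ℕ),
        initialIdeal (degRevLex (SignedIdeal P)) (toricIdeal K (SignedIdeal.point (P := P))) =
          Ideal.span ((fun s => MvPolynomial.monomial s (1 : K)) '' S) ∧
        ∀ s ∈ S, s.degree = 2 ∧ (∀ x, s x ≤ 1) ∧ s (SignedIdeal.origin P) = 0 := by
  classical
  refine ⟨⟨fun x _ => x.point_mem_latticePoints, SignedIdeal.point_injective.injOn, fun c hc => ?_⟩,
    fun _ hlt => ?_⟩
  · obtain ⟨x, hx⟩ := SignedIdeal.exists_point_eq hc
    exact ⟨x, trivial, hx⟩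
  have hG := SignedIdeal.isGroebnerBasis_binomialSet K hlt
  refine ⟨hG, fun x y z w h => ?_, {s | ∃ x y z w : SignedIdeal P,
    (SignedIdeal.IsCancel x y z w ∨ SignedIdeal.IsSignedHibi x y z w) ∧
      s = Finsupp.single x 1 + Finsupp.single y 1}, ?_, ?_⟩
  · rw [SignedIdeal.initialMonomial_binomial hlt h]
    simp [MvPolynomial.X, MvPolynomial.monomial_mul]
  · rw [← hG.2.2.2]
    congr 1
    ext g
    constructor
    · rintro ⟨_, ⟨x, y, z, w, h, rfl⟩, rfl⟩
      exact ⟨_, ⟨x, y, z, w, h, rfl⟩, (SignedIdeal.initialMonomial_binomial hlt h).symm⟩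
    · rintro ⟨_, ⟨x, y, z, w, h, rfl⟩, rfl⟩
      exact ⟨_, ⟨x, y, z, w, h, rfl⟩, SignedIdeal.initialMonomial_binomial hlt h⟩
  · rintro _ ⟨x, y, z, w, h, rfl⟩
    have hxy := SignedIdeal.ne_of_relation h
    obtain ⟨hx, hy⟩ := SignedIdeal.ne_origin_of_relation h
    refine ⟨by simp [map_add], fun i => ?_, by simp [hx, hy]⟩
    simp only [Finsupp.add_apply, Finsupp.single_apply]
    split_ifs with h1 h2 <;> simp
    -- An exponent `2` would force `x = y`.
    exact hxy (h1.trans h2.symm)
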